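/- **Theorem.** For a finite simple graph $G$, let $\mathcal S(G)$ be the set of real symmetric matrices $A=(a_{ij})$, with rows and columns indexed by $V(G)$, such that for $i\neq j$ one has $a_{ij}\neq 0$ if and only if $\{i,j\}\in E(G)$ (the diagonal entries are arbitrary). A real symmetric matrix $A$ has the *strong spectral property* (SSP) if the only real symmetric matrix $X$ with $A\circ X=I\circ X=O$ and $AX-XA=O$ is $X=O$, where $\circ$ is the entrywise product. Let $\operatorname{spec}(A)$ be the multiset of eigenvalues of $A$, let $A(v)$ be $A$ with the row and the column of $v$ removed, and let $\lambda^{(s)}$ denote $s$ copies of $\lambda$; unions of spectra below are unions of multisets, with multiplicities added. Let $G\oplus_v K_{s+1}$ be the graph obtained from the disjoint union of $G$ and the complete graph $K_{s+1}$ by identifying the vertex $v$ of $G$ with one vertex of $K_{s+1}$; this vertex is again called $v$. Let $G$ be a finite simple graph, let $A\in\mathcal S(G)$ have the SSP, let $v\in V(G)$, and let $\lambda\in\mathbb R$ with $\lambda\notin\operatorname{spec}(A)\cup\operatorname{spec}(A(v))$. Then for every integer $s\ge 1$ there is a matrix $A'\in\mathcal S(G\oplus_v K_{s+1})$ with the SSP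 such that $$\operatorname{spec}(A')=\operatorname{spec}(A)\cup\{\lambda^{(s)}\}.$$ Moreover, $A'$ can be chosen arbitrarily close to $A\oplus\lambda I_s$, where $I_s$ is indexed by $V(K_{s+1})\setminus\{v\}$, and at the same time such that the $(i,i)$-entry of $A'$ is different from $\lambda$ for every $i\in V(K_{s+1})\setminus\{v\}$. That is, every neighbourhood of $A\oplus\lambda I_s$ in the space of real square matrices of order $|V(G)|+s$ contains a matrix $A'$ with all of these properties. -/

import Mathlib

open scoped Topology Matrix

noncomputable section

namespace IEPG

/-- The set `S(G)` of real symmetric matrices, indexed by the vertices of `G`, whose off-diagonal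
`(i, j)`-entry is nonzero exactly when `i` and `j` are adjacent. The diagonal is free. -/
def matricesOf {V : Type*} (G : SimpleGraph V) : Set (Matrix V V ℝ) :=
  {A | A.IsSymm ∧ ∀ i j, i ≠ j → (A i j ≠ 0 ↔ G.Adj i j)}

/-- The strong spectral property: the only symmetric `X` with `A ∘ X = I ∘ X = O` (entrywise
products) and `A X - X A = O` is `X = O`. -/
def HasSSP {V : Type*} [Fintype V] [DecidableEq V] (A : Matrix V V ℝ) : Prop :=
  ∀ X : Matrix V V ℝ, X.IsSymm → A ⊙ X = 0 → (1 : Matrix V V ℝ) ⊙ X = 0 →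
    A * X - X * A = 0 → X = 0

/-- The spectrum as the multiset of real eigenvalues with (algebraic) multiplicities. For a
symmetric real matrix this has as many elements as the matrix has rows, and algebraic and
geometric multiplicities agree. -/
def spec {V : Type*} [Fintype V] [DecidableEq V] (A : Matrix V V ℝ) : Multiset ℝ :=
  A.charpoly.roots

/-- The submatrix `A(v)`, with the row and the column of `v` removed. -/
def deleteVertex {V : Type*} (A : Matrix V V ℝ) (v : V) : Matrix {i // i ≠ v} {i // i ≠ v} ℝ :=
  A.submatrix Subtype.val Subtype.val

/-- The direct sum of two square matrices. -/
def directSum {V W : Type*} (A : Matrix V V ℝ) (B : Matrix W W ℝ) : Matrix (V ⊕ W) (V ⊕ W) ℝ :=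
  Matrix.fromBlocks A 0 0 B

/-- The vertex-sum of `G` and `H`: the disjoint union of `G` and `H` with the vertex `w` of `H`
identified with the vertex `v` of `G`. The merged vertex is represented by `Sum.inl v`, and the
other vertices of `H` by `Sum.inr`. -/
def vertexSum {V W : Type*} (G : SimpleGraph V) (v : V) (H : SimpleGraph W) (w : W) :
    SimpleGraph (V ⊕ {x : W // x ≠ w}) where
  Adj
    | Sum.inl a, Sum.inl b => G.Adj a b
    | Sum.inl a, Sum.inr y => a = v ∧ H.Adj w y
    | Sum.inr x, Sum.inl b => b = v ∧ H.Adj w x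
    | Sum.inr x, Sum.inr y => H.Adj x y
  symm := ⟨by
    rintro (a | x) (b | y) h
    · exact h.symm
    · exact h
    · exact h
    · exact h.symm⟩
  loopless := ⟨by
    rintro (a | x) h
    · exact G.irrefl h
    · exact H.irrefl h⟩

end IEPG

end

/-!
Let `n = |V(G)|`. A symmetric matrix on `G ⊕_v K_{s+1}` near `A ⊕ μ I_s` that keeps `μ` with
multiplicity `s` has `A' - μ I` of rank `n`, so it is determined by its upper left block `N + μ I`
and the weights joining `v` to the new vertices. With all these weights equal to `r`, the Schur
complement forces the new block to be `μ I + c r² J`, where `c = (N⁻¹)_{vv}` and `J` is the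
all-ones matrix. This is `borderedClique`. As `μ` is an eigenvalue neither of `A` nor of `A(v)`,
`c` stays away from zero, so for `r ≠ 0` the new block has no zero entry off the diagonal and no
diagonal entry `μ`.

Spectrum: `A' - μ I = Rᵀ N R` with `R = [I | N⁻¹ e_v rᵀ]`, so its nonzero eigenvalues are those of
`N R Rᵀ = N (I + s r² N⁻¹ e_v e_vᵀ N⁻¹)` (`charpoly_borderedClique`). It remains to find, for
small `r > 0`, a matrix `N` in the pattern of `G` near `A - μ I` for which this product has the
spectrum of `A - μ I`. It suffices that `Wᵀ N W = A - μ I` and `W Wᵀ = I + s r² N⁻¹ e_v e_vᵀ N⁻¹`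
for some `W`. At `r = 0` these equations are solved by `N = A - μ I`, `W = I`, and the strong
spectral property of `A` gives that their linearization is surjective
(`exists_commutator_add_pattern_of_hasSSP`), so that the inverse function theorem applies
(`exists_congruence_of_surjective`, `exists_isospectral_of_hasSSP`).

Strong spectral property of `A'`: a matrix `X'` that commutes with `A'` and vanishes on the
diagonal and the edges has zero lower right block, and the commutator equation makes its upper
right block `z rᵀ` for a vector `z`. The equations left for `z` and the upper left block depend
continuously on `N`, `c` and `r`, and at `r = 0` they have only the zero solution by the strong
spectral property of `A`; this persists for nearby parameters (`eventually_injective`,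
`hasSSP_borderedClique`).
-/

open Matrix

/-! ### Injectivity in families of linear maps -/

/-- Injectivity is an open condition in a family of linear maps that depends pointwise continuously
on a parameter: with a left inverse `g` of the map at `x₀`, the determinant of `g ∘ₗ L x` is
continuous in `x` and equals `1` at `x₀`. -/
theorem eventually_injective {X E F : Type*} [TopologicalSpace X]
    [AddCommGroup E] [Module ℝ E] [FiniteDimensional ℝ E]
    [AddCommGroup F] [Module ℝ F] [TopologicalSpace F] [IsTopologicalAddGroup F]
    [ContinuousSMul ℝ F] [T2Space F] [FiniteDimensional ℝ F]
    (L : X → E →ₗ[ℝ] F) (hL : ∀ e, Continuous fun x => L x e) {x₀ : X}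
    (h : Function.Injective (L x₀)) : ∀ᶠ x in 𝓝 x₀, Function.Injective (L x) := by
  obtain ⟨g, hg⟩ := (L x₀).exists_leftInverse_of_injective (LinearMap.ker_eq_bot.mpr h)
  let b := Module.finBasis ℝ E
  have hcont : Continuous fun x => (LinearMap.toMatrix b b (g ∘ₗ L x)).det := by
    refine Continuous.matrix_det (continuous_matrix fun i j => ?_)
    simp only [LinearMap.toMatrix_apply, LinearMap.comp_apply]
    exact ((b.coord i ∘ₗ g).continuous_of_finiteDimensional).comp (hL (b j))
  have h₀ : (LinearMap.toMatrix b b (g ∘ₗ L x₀)).det ≠ 0 := by simp [hg]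
  filter_upwards [hcont.continuousAt.eventually_ne h₀] with x hx
  rw [LinearMap.det_toMatrix] at hx
  have hbij := (LinearMap.equivOfDetNeZero _ hx).injective
  exact Function.Injective.of_comp (f := g) hbij

/-! ### The surjectivity contained in the strong spectral property -/

/-- The symmetrization `H + Hᵀ`, restricted to the diagonal and to the support of `A`. For symmetric
`A`, the image is the space of symmetric matrices whose off-diagonal support lies in that of `A`;
parametrizing this space by all matrices `H` avoids working with a subspace. -/
noncomputable def patternSymm {V : Type*} [DecidableEq V] (A : Matrix V V ℝ) :
    Matrix V V ℝ →ₗ[ℝ] Matrix V V ℝ where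
  toFun H := Matrix.of fun i j => if i = j ∨ A i j ≠ 0 then H i j + H j i else 0
  map_add' H K := by ext i j; simp only [of_apply, Matrix.add_apply]; split_ifs <;> ring
  map_smul' c H := by
    ext i j
    simp only [of_apply, Matrix.smul_apply, smul_eq_mul, RingHom.id_apply]
    split_ifs <;> ring

theorem patternSymm_single {V : Type*} [DecidableEq V] {A : Matrix V V ℝ} (hA : A.IsSymm)
    {i j : V} (h : i = j ∨ A i j ≠ 0) :
    patternSymm A (single i j 1) = single i j 1 + single j i 1 := by
  ext a b
  simp only [patternSymm, LinearMap.coe_mk, AddHom.coe_mk, of_apply, Matrix.add_apply, single_apply]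
  by_cases hab : a = b ∨ A a b ≠ 0
  · simp only [if_pos hab, and_comm]
  · have h₁ : ¬(i = a ∧ j = b) := by rintro ⟨rfl, rfl⟩; exact hab h
    have h₂ : ¬(j = a ∧ i = b) := by
      rintro ⟨rfl, rfl⟩
      rw [hA.apply] at hab
      exact hab (h.imp_left Eq.symm)
    simp only [if_neg hab, if_neg h₁, if_neg h₂, add_zero]

theorem patternSymm_isSymm {V : Type*} [DecidableEq V] {A : Matrix V V ℝ} (hA : A.IsSymm)
    (H : Matrix V V ℝ) :
    (patternSymm A H).IsSymm := by
  ext i j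
  have : (j = i ∨ A j i ≠ 0) ↔ (i = j ∨ A i j ≠ 0) := by rw [hA.apply, eq_comm]
  simp only [patternSymm, LinearMap.coe_mk, AddHom.coe_mk, of_apply, transpose_apply, this,
    add_comm]

theorem eq_of_isSymm_of_add_skew {V : Type*} {X D Y : Matrix V V ℝ} (hX : X.IsSymm) (hY : Y.IsSymm)
    (h : X + (D - Dᵀ) = Y) : X = Y := by
  have h' := congrArg transpose h
  rw [transpose_add, transpose_sub, transpose_transpose, hX.eq, hY.eq] at h'
  have h2 : (2 : ℝ) • X = (2 : ℝ) • Y := by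
    rw [two_smul, two_smul]
    nth_rewrite 1 [← h]
    rw [← h']
    abel
  exact smul_right_injective _ two_ne_zero h2

section

variable {V ι : Type*} [Fintype V] [DecidableEq V] [Fintype ι] [DecidableEq ι]

/-- The dual form of the strong spectral property: commutators of `A` with skew-symmetric matrices,
together with symmetric matrices in the pattern of `A`, span the symmetric matrices. The term
`D - Dᵀ` adds the skew-symmetric matrices, so that all matrices are reached. -/
theorem exists_commutator_add_pattern_of_hasSSP {A : Matrix V V ℝ} (hA : A.IsSymm)
    (hSSP : IEPG.HasSSP A) (Y : Matrix V V ℝ) :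
    ∃ L H D : Matrix V V ℝ, A * (L - Lᵀ) - (L - Lᵀ) * A + patternSymm A H + (D - Dᵀ) = Y := by
  let tr : Matrix V V ℝ →ₗ[ℝ] Matrix V V ℝ := (transposeLinearEquiv V V ℝ ℝ).toLinearMap
  let sk : Matrix V V ℝ →ₗ[ℝ] Matrix V V ℝ := LinearMap.id - tr
  let Φ : Matrix V V ℝ × Matrix V V ℝ × Matrix V V ℝ →ₗ[ℝ] Matrix V V ℝ :=
    ((LinearMap.mulLeft ℝ A - LinearMap.mulRight ℝ A) ∘ₗ sk).coprod
      ((patternSymm A).coprod sk)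
  have hΦ : ∀ L H D, Φ (L, H, D) =
      A * (L - Lᵀ) - (L - Lᵀ) * A + patternSymm A H + (D - Dᵀ) := by
    intro L H D
    simp [Φ, sk, tr, add_assoc, LinearMap.mulLeft, LinearMap.mulRight]
  suffices h : Φ.range = ⊤ by
    obtain ⟨⟨L, H, D⟩, h⟩ := LinearMap.range_eq_top.mp h Y
    exact ⟨L, H, D, (hΦ L H D) ▸ h⟩
  by_contra hne
  obtain ⟨f, hf0, hf⟩ := Submodule.exists_le_ker_of_lt_top _ (lt_top_iff_ne_top.mpr hne)
  have hz : ∀ L H D, f (A * (L - Lᵀ) - (L - Lᵀ) * A + patternSymm A H + (D - Dᵀ)) = 0 := by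
    intro L H D
    rw [← hΦ]
    exact hf ⟨_, rfl⟩
  apply hf0
  -- The functional `f` is `Z ↦ tr (X Z)`; the strong spectral property applies to `X`.
  let X : Matrix V V ℝ := Matrix.of fun i j => f (single j i 1)
  have hfX : ∀ Z : Matrix V V ℝ, f Z = (X * Z).trace := by
    intro Z
    conv_lhs => rw [matrix_eq_sum_single Z]
    simp only [map_sum, trace, diag_apply, mul_apply]
    rw [Finset.sum_comm]
    refine Finset.sum_congr rfl fun j _ => Finset.sum_congr rfl fun i _ => ?_
    rw [← mul_one (Z i j), ← smul_eq_mul, ← smul_single, map_smul]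
    simp [X, mul_comm]
  have hXs : X.IsSymm := by
    ext i j
    have := hz 0 0 (single i j 1)
    simp only [transpose_zero, sub_zero, mul_zero, zero_mul, map_zero, zero_add, transpose_single,
      map_sub] at this
    simpa [X] using sub_eq_zero.mp this
  have hdiag : ∀ i j, (i = j ∨ A i j ≠ 0) → X i j = 0 := by
    intro i j hij
    have := hz 0 (single i j 1) 0
    have hp := patternSymm_single hA hij
    simp only [transpose_zero, sub_zero, mul_zero, zero_mul, hp, zero_add, add_zero, map_add]
      at this
    have h2 := hXs.apply i j
    simp only [X, of_apply] at h2 ⊢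
    linarith
  have hcomm : A * X - X * A = 0 := by
    -- `[X, A]` is skew-symmetric, and vanishing of `f` on `[A, C - Cᵀ]` reads `tr (C * C) = 0`.
    set C : Matrix V V ℝ := X * A - A * X with hC
    have hCt : Cᵀ = -C := by simp [hC, hA.eq, hXs.eq]
    have h1 := hz C 0 0
    rw [hCt, hfX] at h1
    have h2 : (C * Cᵀ).trace = 0 := by
      have : (X * (A * (C - -C) - (C - -C) * A + patternSymm A 0 + (0 - 0ᵀ))).trace =
          2 * (C * C).trace := by
        have e1 : (X * (A * C)).trace = (X * A * C).trace := by rw [mul_assoc]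
        have e2 : (X * (C * A)).trace = (A * X * C).trace := by
          rw [← mul_assoc, trace_mul_comm, mul_assoc]
        have e3 : (C * C).trace = (X * A * C).trace - (A * X * C).trace := by
          rw [← trace_sub, ← sub_mul]
        rw [e3]
        simp only [sub_neg_eq_add, map_zero, transpose_zero, sub_zero, add_zero, mul_add, add_mul,
          mul_sub, trace_sub, trace_add, e1, e2]
        ring
      rw [this] at h1
      rw [hCt, mul_neg, trace_neg]
      linarith
    have h3 : C = 0 := by
      rw [← conjTranspose_eq_transpose_of_trivial] at h2
      exact trace_mul_conjTranspose_self_eq_zero_iff.mp h2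
    rw [← neg_sub, ← hC, h3, neg_zero]
  have hX0 : X = 0 := by
    refine hSSP X hXs ?_ ?_ hcomm
    · ext i j
      by_cases h : A i j = 0
      · simp [h]
      · simp [hdiag i j (Or.inr h)]
    · ext i j
      by_cases h : i = j
      · simp [hdiag i j (Or.inl h)]
      · simp [h]
  ext Z
  simp [hfX, hX0]

/-! ### Matrices in the pattern with a prescribed perturbed spectrum -/

/-- An application of the inverse function theorem. The map `(W, H, D₁, D₂, U, r) ↦ (τ W * N * W +
(D₁ - τ D₁), W * τ W - k r² • U E τ(U) + (D₂ - τ D₂), N U, r)` with `N = A + π H` is open at `(1,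
0, 0, 0, B, 0)`, where its value is `(A, 1, 1, 0)`, so it attains `(A, 1, 1, r)` for small `r >
0`. In the application `τ` is transposition and the `Dᵢ` only absorb skew-symmetric matrices,
which makes the derivative surjective onto the full algebra. -/
theorem exists_congruence_of_surjective {M : Type*} [NormedRing M] [NormedAlgebra ℝ M]
    [FiniteDimensional ℝ M] (τ π : M →ₗ[ℝ] M) (hτ : τ 1 = 1) {A B : M} (hAB : A * B = 1) (E : M)
    (k : ℝ) (hsurj : ∀ Y, ∃ L H D, A * (L - τ L) - (L - τ L) * A + π H + (D - τ D) = Y)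
    (hττ : ∀ X, τ (τ X) = X) {O : Set (M × M × ℝ)} (hO : O ∈ 𝓝 (A, B, (0 : ℝ))) :
    ∃ W H D₁ D₂ U : M, ∃ r : ℝ, (A + π H, U, r) ∈ O ∧ 0 < r ∧
      τ W * (A + π H) * W + (D₁ - τ D₁) = A ∧
      W * τ W - (k * r ^ 2) • (U * E * τ U) + (D₂ - τ D₂) = 1 ∧ (A + π H) * U = 1 := by
  have : CompleteSpace M := FiniteDimensional.complete ℝ M
  let T : M →L[ℝ] M := τ.toContinuousLinearMap
  let P : M →L[ℝ] M := π.toContinuousLinearMap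
  have hT : ∀ X, T X = τ X := fun _ => rfl
  have hP : ∀ X, P X = π X := fun _ => rfl
  -- Only the coordinates of the parameter space matter, so the product itself is kept opaque.
  obtain ⟨S, _, _, _, W, H, D₁, D₂, U, R, hS⟩ : ∃ (S : Type _) (_ : NormedAddCommGroup S)
      (_ : NormedSpace ℝ S) (_ : CompleteSpace S) (W H D₁ D₂ U : S →L[ℝ] M)
      (R : S →L[ℝ] ℝ), ∀ w h d₁ d₂ u r, ∃ p,
        W p = w ∧ H p = h ∧ D₁ p = d₁ ∧ D₂ p = d₂ ∧ U p = u ∧ R p = r :=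
    ⟨M × M × M × M × M × ℝ,
      inferInstance, inferInstance, inferInstance, .fst ℝ _ _, .fst ℝ _ _ ∘L .snd ℝ _ _,
      .fst ℝ _ _ ∘L .snd ℝ _ _ ∘L .snd ℝ _ _,
      .fst ℝ _ _ ∘L .snd ℝ _ _ ∘L .snd ℝ _ _ ∘L .snd ℝ _ _,
      .fst ℝ _ _ ∘L .snd ℝ _ _ ∘L .snd ℝ _ _ ∘L .snd ℝ _ _ ∘L .snd ℝ _ _,
      .snd ℝ _ _ ∘L .snd ℝ _ _ ∘L .snd ℝ _ _ ∘L .snd ℝ _ _ ∘L .snd ℝ _ _,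
      fun w h d₁ d₂ u r => ⟨(w, h, d₁, d₂, u, r), rfl, rfl, rfl, rfl, rfl, rfl⟩⟩
  obtain ⟨a, aW, aH, aD₁, aD₂, aU, aR⟩ := hS 1 0 0 0 B 0
  let N : S → M := fun p => A + P (H p)
  let Φ : S → M × M × M × ℝ := fun p =>
    (T (W p) * N p * W p + (D₁ p - T (D₁ p)),
      W p * T (W p) - (k * R p ^ 2) • (U p * E * T (U p)) + (D₂ p - T (D₂ p)), N p * U p, R p)
  have aN : N a = A := by simp [N, aH]
  have hΦa : Φ a = (A, 1, 1, 0) := by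
    simp [Φ, aN, aW, aD₁, aD₂, aU, aR, hT, hτ, hAB]
  have hmap : Filter.map Φ (𝓝 a) = 𝓝 (Φ a) := by
    have hN' : HasStrictFDerivAt N (P ∘L H) a := (P ∘L H).hasStrictFDerivAt.const_add A
    have h1 := (((T ∘L W).hasStrictFDerivAt (x := a)).mul' hN').mul' (W.hasStrictFDerivAt (x := a))
      |>.add ((D₁ - T ∘L D₁).hasStrictFDerivAt (x := a))
    have hr : HasStrictFDerivAt (fun p : S => k * R p ^ 2) (0 : S →L[ℝ] ℝ) a := by
      have := ((R.hasStrictFDerivAt (x := a)).pow 2).const_mul k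
      simpa [aR] using this
    have hu := ((U.hasStrictFDerivAt (x := a)).mul_const' E).mul'
      ((T ∘L U).hasStrictFDerivAt (x := a))
    have h2 := ((W.hasStrictFDerivAt (x := a)).mul' ((T ∘L W).hasStrictFDerivAt (x := a))).sub
      (hr.smul hu) |>.add ((D₂ - T ∘L D₂).hasStrictFDerivAt (x := a))
    have h3 := hN'.mul' (U.hasStrictFDerivAt (x := a))
    have hΦ := h1.prodMk (h2.prodMk (h3.prodMk (R.hasStrictFDerivAt (x := a))))
    refine hΦ.map_nhds_eq_of_surj (LinearMap.range_eq_top.mpr ?_)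
    rintro ⟨Y₁, Y₂, Y₃, σ⟩
    -- With `W' = Y₂ / 2 + (L - τ L)` and `D₂' = Y₂ / 2` the second component is `Y₂`, and the first
    -- one becomes an instance of `hsurj`.
    obtain ⟨L, K, D, hLKD⟩ := hsurj (Y₁ - ((2⁻¹ : ℝ) • (τ Y₂ * A) + (2⁻¹ : ℝ) • (A * Y₂)))
    obtain ⟨p, pW, pH, pD₁, pD₂, pU, pR⟩ := hS ((2⁻¹ : ℝ) • Y₂ + (L - τ L)) K D ((2⁻¹ : ℝ) • Y₂)
      (B * (Y₃ - π K * B)) σ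
    refine ⟨p, ?_⟩
    simp only [Pi.mul_apply, ContinuousLinearMap.comp_apply, aW, hT, hτ, aN, one_mul,
      MulOpposite.op_one, one_smul, smul_add, aR, ne_eq, OfNat.ofNat_ne_zero, not_false_eq_true,
      zero_pow, mul_zero, aU, zero_smul, add_zero, ContinuousLinearMap.zero_smulRight, sub_zero,
      ContinuousLinearMap.coe_prod, ContinuousLinearMap.toLinearMap_add,
      ContinuousLinearMap.toLinearMap_smul, ContinuousLinearMap.toLinearMap_comp,
      ContinuousLinearMap.toLinearMap_sub, LinearMap.prod_apply, Function.prod_apply,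
      LinearMap.add_apply, LinearMap.smul_apply, ContinuousLinearMap.coe_coe, pW, smul_eq_mul,
      LinearMap.coe_comp, Function.comp_apply, pH, hP, map_add, map_smul, map_sub, hττ,
      MulOpposite.smul_eq_mul_unop, MulOpposite.unop_op, Algebra.smul_mul_assoc,
      LinearMap.sub_apply, pD₁, pD₂, pU, pR, Prod.mk.injEq, and_true]
    refine ⟨?_, ?_, ?_⟩
    · rw [eq_comm, sub_eq_iff_eq_add] at hLKD
      rw [hLKD]
      simp only [mul_add, mul_sub, sub_mul, mul_smul_comm]
      abel
    · module
    · rw [← mul_assoc, hAB]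
      simp
  let g : S → M × M × ℝ := fun p => (N p, U p, R p)
  have hg : Continuous g := by fun_prop
  have hga : g a = (A, B, 0) := by simp [g, aN, aU, aR]
  have hO' : Φ '' (g ⁻¹' O) ∈ 𝓝 ((A, 1, 1, 0) : M × M × M × ℝ) := by
    rw [← hΦa, ← hmap]
    exact Filter.image_mem_map (hg.continuousAt (hga ▸ hO))
  have hlim : Filter.Tendsto (fun r : ℝ => ((A, 1, 1, r) : M × M × M × ℝ))
      (𝓝[>] 0) (𝓝 (A, 1, 1, 0)) :=
    Filter.Tendsto.mono_left (Continuous.tendsto (by fun_prop) 0) nhdsWithin_le_nhds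
  obtain ⟨r, ⟨p, hpO, hp⟩, hr0⟩ := ((hlim.eventually_mem hO').and self_mem_nhdsWithin).exists
  simp only [Φ, Prod.mk.injEq] at hp
  obtain ⟨e₁, e₂, e₃, rfl⟩ := hp
  exact ⟨W p, H p, D₁ p, D₂ p, U p, R p, hpO, hr0, e₁, e₂, e₃⟩

section
attribute [local instance] Matrix.linftyOpNormedRing Matrix.linftyOpNormedAlgebra

/-- If `A` is invertible and has the strong spectral property, then arbitrarily close to `A` there
are symmetric matrices `N` in the pattern of `A`, with inverse `U`, such that `N * (1 + k r² • U E
Uᵀ)` has the characteristic polynomial of `A` for some small `r > 0`. Indeed `Wᵀ N W = A` and `W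
Wᵀ = 1 + k r² • U E Uᵀ` for some `W`. -/
theorem exists_isospectral_of_hasSSP {A : Matrix V V ℝ} (hA : A.IsSymm) (hSSP : IEPG.HasSSP A)
    (hdet : A.det ≠ 0) {E : Matrix V V ℝ} (hE : E.IsSymm) (k : ℝ)
    {O : Set (Matrix V V ℝ × Matrix V V ℝ × ℝ)} (hO : O ∈ 𝓝 (A, A⁻¹, (0 : ℝ))) :
    ∃ H U : Matrix V V ℝ, ∃ r : ℝ, (A + patternSymm A H, U, r) ∈ O ∧ 0 < r ∧
      (A + patternSymm A H) * U = 1 ∧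
      ((A + patternSymm A H) * (1 + (k * r ^ 2) • (U * E * Uᵀ))).charpoly = A.charpoly := by
  obtain ⟨W, H, D₁, D₂, U, r, hmem, hr, e₁, e₂, e₃⟩ :=
    exists_congruence_of_surjective (transposeLinearEquiv V V ℝ ℝ).toLinearMap (patternSymm A)
      transpose_one (mul_nonsing_inv A hdet.isUnit) E k
      (exists_commutator_add_pattern_of_hasSSP hA hSSP) transpose_transpose hO
  refine ⟨H, U, r, hmem, hr, e₃, ?_⟩
  have hN : (A + patternSymm A H).IsSymm := hA.add (patternSymm_isSymm hA H)
  have h₁ : Wᵀ * (A + patternSymm A H) * W = A := by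
    refine eq_of_isSymm_of_add_skew ?_ hA e₁
    simp [IsSymm, transpose_mul, hN.eq, Matrix.mul_assoc]
  have h₂ : W * Wᵀ - (k * r ^ 2) • (U * E * Uᵀ) = 1 := by
    refine eq_of_isSymm_of_add_skew ?_ isSymm_one e₂
    simp [IsSymm, transpose_mul, hE.eq, Matrix.mul_assoc]
  rw [← sub_eq_iff_eq_add.mp h₂, ← Matrix.mul_assoc, charpoly_mul_comm, ← Matrix.mul_assoc, h₁]
end

/-! ### Attaching a clique: spectrum -/

/-- The matrix `B`, bordered by a block indexed by `ι`: every new vertex is joined to `v` with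
weight `r`, and the new block is `μ • 1` plus the constant matrix `c * r ^ 2`. If `r` and `c` are
nonzero, the new vertices and `v` form a clique. -/
def borderedClique (ι : Type*) [DecidableEq ι] (B : Matrix V V ℝ) (v : V) (μ r c : ℝ) :
    Matrix (V ⊕ ι) (V ⊕ ι) ℝ :=
  fromBlocks B (vecMulVec (Pi.single v 1) fun _ => r) (vecMulVec (fun _ => r) (Pi.single v 1))
    (μ • 1 + vecMulVec (fun _ => r) fun _ => c * r)

/-- With `c = (N⁻¹) v v`, the bordered matrix is `μ • 1 + Rᵀ N R` where
`R = [1 | N⁻¹ e_v rᵀ]`, and apart from zeros `Rᵀ N R` has the spectrum of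
`N R Rᵀ = N * (1 + |ι| r² • U E Uᵀ)` with `U = N⁻¹` and `E = e_v e_vᵀ`. -/
theorem charpoly_borderedClique {N U : Matrix V V ℝ} (hN : N.IsSymm) (hU : N * U = 1) (v : V)
    (μ r : ℝ) {A : Matrix V V ℝ}
    (h : (N * (1 + (Fintype.card ι * r ^ 2) • (U * single v v 1 * Uᵀ))).charpoly =
      (A - μ • 1).charpoly) :
    (borderedClique ι (N + μ • 1) v μ r (U v v)).charpoly =
      (Polynomial.X - Polynomial.C μ) ^ Fintype.card ι * A.charpoly := by
  let R : Matrix V (V ⊕ ι) ℝ := fromCols 1 (vecMulVec (U *ᵥ Pi.single v 1) fun _ => r)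
  have hNu : N *ᵥ (U *ᵥ Pi.single v 1) = Pi.single v 1 := by
    rw [mulVec_mulVec, hU, one_mulVec]
  have hfac : borderedClique ι (N + μ • 1) v μ r (U v v) - scalar (V ⊕ ι) μ = Rᵀ * (N * R) := by
    have huN : (U *ᵥ Pi.single v 1) ᵥ* N = Pi.single v 1 := by
      rw [← mulVec_transpose, hN.eq, hNu]
    have hscalar : scalar (V ⊕ ι) μ = fromBlocks (μ • 1) 0 0 (μ • 1) := by
      rw [scalar_apply, ← smul_one_eq_diagonal, ← fromBlocks_one, fromBlocks_smul, smul_zero,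
        smul_zero]
    have hR : Rᵀ * (N * R) = fromBlocks N (vecMulVec (Pi.single v 1) fun _ => r)
        (vecMulVec (fun _ => r) (Pi.single v 1)) (vecMulVec (fun _ => r) fun _ => U v v * r) := by
      rw [mul_fromCols, mul_one, mul_vecMulVec, hNu, transpose_fromCols, transpose_one,
        transpose_vecMulVec, fromRows_mul_fromCols, Matrix.one_mul, Matrix.one_mul, vecMulVec_mul,
        huN, vecMulVec_mul_vecMulVec]
      congr 2
      ext
      simp
    rw [hR, hscalar, borderedClique, sub_eq_iff_eq_add, fromBlocks_add]
    simp [add_comm]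
  have hRR : N * R * Rᵀ = N * (1 + (Fintype.card ι * r ^ 2) • (U * single v v 1 * Uᵀ)) := by
    have hUU : U * single v v 1 * Uᵀ =
        vecMulVec (U *ᵥ Pi.single v 1) (U *ᵥ Pi.single v 1) := by
      rw [single_eq_single_vecMulVec_single, mul_vecMulVec, vecMulVec_mul, vecMul_transpose]
    have hR : R * Rᵀ = 1 + (Fintype.card ι * r ^ 2) • (U * single v v 1 * Uᵀ) := by
      rw [hUU, transpose_fromCols, fromCols_mul_fromRows, transpose_one, mul_one,
        transpose_vecMulVec, vecMulVec_mul_vecMulVec]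
      congr 1
      ext i j
      simp [vecMulVec_apply, dotProduct]
      ring
    rw [Matrix.mul_assoc N, hR]
  have hcp : (borderedClique ι (N + μ • 1) v μ r (U v v) - scalar (V ⊕ ι) μ).charpoly =
      Polynomial.X ^ Fintype.card ι * (A - scalar V μ).charpoly := by
    rw [hfac, charpoly_mul_comm_of_le _ _ (by simp), hRR, h, scalar_apply, ← smul_one_eq_diagonal]
    simp
  rw [charpoly_sub_scalar, charpoly_sub_scalar] at hcp
  have := congrArg (fun p => p.comp (Polynomial.X - Polynomial.C μ)) hcp
  simpa [Polynomial.comp_assoc] using this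

/-! ### Attaching a clique: strong spectral property -/

/-- The linear map in `q = (X, z)` whose kernel decides the strong spectral property of the bordered
matrix, for the parameters `p = (N, c, t)`. A matrix `X'` as in the strong spectral property of
the bordered matrix has upper left block `X` and upper right block with all columns proportional
to `z`, the lower right block being `0`; the components are the conditions on `X` and the two
upper blocks of the commutator equation, with `t = |ι| r²`. -/
noncomputable def sspMap (A : Matrix V V ℝ) (v : V) (p : Matrix V V ℝ × ℝ × ℝ) :
    Matrix V V ℝ × (V → ℝ) →ₗ[ℝ]
      Matrix V V ℝ × Matrix V V ℝ × Matrix V V ℝ × Matrix V V ℝ × (V → ℝ) where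
  toFun q := (q.1 - q.1ᵀ, A ⊙ q.1, 1 ⊙ q.1,
    p.1 * q.1 - q.1 * p.1 -
      p.2.2 • (vecMulVec q.2 (Pi.single v 1) - vecMulVec (Pi.single v 1) q.2),
    p.1 *ᵥ q.2 - q.1 *ᵥ Pi.single v 1 - (p.2.1 * p.2.2) • q.2)
  map_add' q q' := by
    simp only [Prod.fst_add, Prod.snd_add, transpose_add, hadamard_add, mul_add, add_mul,
      add_vecMulVec, vecMulVec_add, mulVec_add, add_mulVec, smul_add, Prod.mk_add_mk, Prod.mk.injEq,
      true_and]
    refine ⟨by abel, by module, by module⟩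
  map_smul' c q := by
    simp only [Prod.smul_fst, Prod.smul_snd, transpose_smul, hadamard_smul, mul_smul_comm,
      smul_mul_assoc, smul_vecMulVec, vecMulVec_smul, mulVec_smul, smul_mulVec, RingHom.id_apply,
      Prod.smul_mk, Prod.mk.injEq, true_and]
    refine ⟨by module, by module, by module⟩

/-- At `t = 0` the kernel is trivial: the strong spectral property of `A` gives `X = 0`, and then
`A z = 0` gives `z = 0`. -/
theorem eventually_injective_sspMap {A : Matrix V V ℝ} (hSSP : IEPG.HasSSP A) (hdet : A.det ≠ 0)
    (v : V) (c : ℝ) :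
    ∀ᶠ p in 𝓝 ((A, c, 0) : Matrix V V ℝ × ℝ × ℝ), Function.Injective (sspMap A v p) := by
  refine eventually_injective (sspMap A v) (fun q => ?_) ?_
  · simp only [sspMap, LinearMap.coe_mk, AddHom.coe_mk]
    fun_prop
  · refine (injective_iff_map_eq_zero _).mpr ?_
    rintro ⟨X, z⟩ h
    simp only [sspMap, LinearMap.coe_mk, AddHom.coe_mk, zero_smul, sub_zero, mul_zero,
      Prod.mk_eq_zero] at h
    obtain ⟨h₁, h₂, h₃, h₄, h₅⟩ := h
    have hX : X = 0 := hSSP X (sub_eq_zero.mp h₁).symm h₂ h₃ h₄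
    rw [hX, zero_mulVec, sub_zero] at h₅
    rw [hX, eq_zero_of_mulVec_eq_zero hdet h₅]
    rfl

theorem hasSSP_borderedClique [Nonempty ι] {A N U : Matrix V V ℝ} (hN : N * U = 1) {v : V}
    {μ r c : ℝ}
    (hpat : ∀ i j, A i j ≠ 0 → N i j ≠ 0) (hr : r ≠ 0) (hc : c ≠ 0)
    (hinj : Function.Injective (sspMap A v (N, c, Fintype.card ι * r ^ 2))) :
    IEPG.HasSSP (borderedClique ι (N + μ • 1) v μ r c) := by
  intro X hX hA hI hcomm
  obtain ⟨X₁, Z, Z', X₂, rfl⟩ : ∃ X₁ Z Z' X₂, X = fromBlocks X₁ Z Z' X₂ :=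
    ⟨_, _, _, _, (fromBlocks_toBlocks X).symm⟩
  obtain ⟨hX₁, hZ', -, -⟩ := isSymm_fromBlocks_iff.mp hX
  obtain rfl : X₂ = 0 := by
    ext i j
    by_cases hij : i = j
    · simpa [hij] using congrFun₂ hI (Sum.inr i) (Sum.inr j)
    · have := congrFun₂ hA (Sum.inr i) (Sum.inr j)
      simpa [borderedClique, vecMulVec_apply, one_apply, hij, hc, hr] using this
  have hdiag : ∀ i, X₁ i i = 0 := fun i => by
    simpa using congrFun₂ hI (Sum.inl i) (Sum.inl i)
  have hAX : A ⊙ X₁ = 0 := by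
    ext i j
    by_cases hij : i = j
    · simp [hij, hdiag]
    by_cases hz : A i j = 0
    · simp [hz]
    have := congrFun₂ hA (Sum.inl i) (Sum.inl j)
    simpa [borderedClique, one_apply, hij, hz, hpat i j hz] using this
  have hIX : (1 : Matrix V V ℝ) ⊙ X₁ = 0 := by
    ext i j
    by_cases hij : i = j <;> simp [hij, hdiag, one_apply]
  obtain rfl : Zᵀ = Z' := hZ'
  rw [borderedClique, fromBlocks_multiply, fromBlocks_multiply, sub_eq_zero,
    fromBlocks_inj] at hcomm
  obtain ⟨h₁₁, h₁₂, -, -⟩ := hcomm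
  -- The upper right block of the commutator equation forces `Z` to have rank at most one.
  have hNZ : N * Z = vecMulVec (X₁ *ᵥ Pi.single v 1 + c • (Z *ᵥ fun _ => r)) fun _ => r := by
    have hZM : Z * (μ • (1 : Matrix ι ι ℝ) + vecMulVec (fun _ => r) fun _ => c * r) =
        μ • Z + vecMulVec (c • (Z *ᵥ fun _ => r)) fun _ => r := by
      have : (fun _ : ι => c * r) = c • fun _ => r := rfl
      rw [Matrix.mul_add, mul_vecMulVec, this, vecMulVec_smul, smul_vecMulVec]
      simp
    rw [Matrix.mul_zero, add_zero, hZM, Matrix.add_mul, mul_vecMulVec, Matrix.smul_mul,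
      Matrix.one_mul] at h₁₂
    rw [add_vecMulVec]
    refine add_right_cancel (b := μ • Z) (h₁₂.trans ?_)
    abel
  obtain ⟨z, rfl⟩ : ∃ z : V → ℝ, Z = vecMulVec z fun _ => r := by
    refine ⟨U *ᵥ (X₁ *ᵥ Pi.single v 1 + c • (Z *ᵥ fun _ => r)), ?_⟩
    rw [← mul_vecMulVec, ← hNZ, ← Matrix.mul_assoc, mul_eq_one_comm.mp hN, Matrix.one_mul]
  have hrr : (fun _ : ι => r) ⬝ᵥ (fun _ => r) = Fintype.card ι * r ^ 2 := by
    simp [dotProduct, sq]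
  have hz : N *ᵥ z = X₁ *ᵥ Pi.single v 1 + (c * (Fintype.card ι * r ^ 2)) • z := by
    obtain ⟨i⟩ := ‹Nonempty ι›
    ext j
    have := congrFun₂ hNZ j i
    rw [mul_vecMulVec, vecMulVec_apply, vecMulVec_apply, vecMulVec_mulVec, hrr] at this
    have := mul_right_cancel₀ hr this
    rw [this]
    simp
    ring
  have hX₁N : N * X₁ - X₁ * N - (Fintype.card ι * r ^ 2 : ℝ) •
      (vecMulVec z (Pi.single v 1) - vecMulVec (Pi.single v 1) z) = 0 := by
    rw [transpose_vecMulVec, vecMulVec_mul_vecMulVec, vecMulVec_mul_vecMulVec, hrr,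
      Matrix.add_mul, Matrix.mul_add, Matrix.smul_mul, Matrix.mul_smul, Matrix.one_mul,
      Matrix.mul_one, vecMulVec_smul, vecMulVec_smul] at h₁₁
    rw [smul_sub, sub_eq_zero, sub_eq_sub_iff_add_eq_add]
    refine add_right_cancel (b := μ • X₁) (Eq.trans ?_ (h₁₁.trans ?_)) <;> abel
  have hq : sspMap A v (N, c, Fintype.card ι * r ^ 2) (X₁, z) = 0 := by
    simp only [sspMap, LinearMap.coe_mk, AddHom.coe_mk, hAX, hIX, hX₁N, hX₁.eq, sub_self, hz,
      add_sub_cancel_left]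
    rfl
  obtain ⟨rfl, rfl⟩ := Prod.mk_eq_zero.mp (hinj (hq.trans (map_zero _).symm))
  simp

/-! ### Attaching a clique: existence -/

theorem hasSSP_sub_smul_one {A : Matrix V V ℝ} (h : IEPG.HasSSP A) (μ : ℝ) :
    IEPG.HasSSP (A - μ • 1) := by
  intro X hX hAX hIX hcomm
  refine h X hX ?_ hIX ?_
  · rw [sub_eq_add_neg, ← neg_smul, add_hadamard, smul_hadamard, hIX, smul_zero, add_zero] at hAX
    exact hAX
  · rw [← hcomm]
    simp only [sub_mul, mul_sub, smul_mul_assoc, mul_smul_comm, one_mul, mul_one]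
    abel

theorem det_sub_smul_one_ne_zero {A : Matrix V V ℝ} {μ : ℝ} (h : μ ∉ IEPG.spec A) :
    (A - μ • 1).det ≠ 0 := by
  intro h0
  apply h
  rw [IEPG.spec, Polynomial.mem_roots A.charpoly_monic.ne_zero, Polynomial.IsRoot, eval_charpoly,
    ← neg_sub, det_neg, scalar_apply, ← smul_one_eq_diagonal, h0, mul_zero]

/-- If column `v` of `A⁻¹` vanished at `v`, its other entries would form a kernel vector of
`A(v)`. -/
theorem inv_apply_self_ne_zero {A : Matrix V V ℝ} {v : V} (hdet : A.det ≠ 0)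
    (hv : (IEPG.deleteVertex A v).det ≠ 0) : A⁻¹ v v ≠ 0 := by
  intro h0
  have hAA := mul_nonsing_inv A hdet.isUnit
  have hker : IEPG.deleteVertex A v *ᵥ (fun j => A⁻¹ j v) = 0 := by
    ext i
    have := congrFun₂ hAA i v
    rw [mul_apply, one_apply_ne i.2, ← Fintype.sum_subtype_add_sum_subtype (fun j => j ≠ v)] at this
    have hz : ∑ j : {j // ¬j ≠ v}, A i j * A⁻¹ j v = 0 :=
      Finset.sum_eq_zero fun j _ => by rw [not_not.mp j.2, h0, mul_zero]
    rwa [hz, add_zero] at this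
  have hcol : ∀ j, A⁻¹ j v = 0 := by
    intro j
    by_cases hj : j = v
    · rw [hj, h0]
    · exact congrFun (eq_zero_of_mulVec_eq_zero hv hker) ⟨j, hj⟩
  have := congrFun₂ hAA v v
  simp [mul_apply, hcol] at this

/-- The number of vertices attached plays no role beyond the multiplicity of `μ`; the statement
is for an arbitrary nonempty index type `ι`. -/
theorem exists_borderedClique_mem_nhds [Nonempty ι] {G : SimpleGraph V} {A : Matrix V V ℝ}
    (hA : A ∈ IEPG.matricesOf G) (hSSP : IEPG.HasSSP A) {v : V} {μ : ℝ} (hμA : μ ∉ IEPG.spec A)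
    (hμAv : μ ∉ IEPG.spec (IEPG.deleteVertex A v)) {O : Set (Matrix (V ⊕ ι) (V ⊕ ι) ℝ)}
    (hO : O ∈ 𝓝 (IEPG.directSum A (μ • 1))) :
    ∃ B r c, borderedClique ι B v μ r c ∈ O ∧ B ∈ IEPG.matricesOf G ∧ r ≠ 0 ∧ c ≠ 0 ∧
      IEPG.HasSSP (borderedClique ι B v μ r c) ∧ (borderedClique ι B v μ r c).charpoly =
        (Polynomial.X - Polynomial.C μ) ^ Fintype.card ι * A.charpoly := by
  obtain ⟨hAsymm, hAG⟩ := hA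
  set B := A - μ • 1 with hB
  have hBsymm : B.IsSymm := hAsymm.sub (isSymm_one.smul μ)
  have hBdet : B.det ≠ 0 := det_sub_smul_one_ne_zero hμA
  have hBoff : ∀ {i j}, i ≠ j → B i j = A i j := fun hij => by simp [hB, hij]
  have hc : B⁻¹ v v ≠ 0 := by
    refine inv_apply_self_ne_zero hBdet ?_
    have hdel : IEPG.deleteVertex B v = IEPG.deleteVertex A v - μ • 1 := by
      ext i j
      simp [IEPG.deleteVertex, hB, one_apply, Subtype.ext_iff]
    rw [hdel]
    exact det_sub_smul_one_ne_zero hμAv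
  have hnear : ∀ᶠ p in 𝓝 ((B, B⁻¹, 0) : Matrix V V ℝ × Matrix V V ℝ × ℝ),
      (∀ i j, B i j ≠ 0 → p.1 i j ≠ 0) ∧ p.2.1 v v ≠ 0 ∧
      Function.Injective (sspMap B v (p.1, p.2.1 v v, Fintype.card ι * p.2.2 ^ 2)) ∧
      borderedClique ι (p.1 + μ • 1) v μ p.2.2 (p.2.1 v v) ∈ O := by
    refine .and ?_ (.and ?_ (.and ?_ ?_))
    · refine Filter.eventually_all.mpr fun i => Filter.eventually_all.mpr fun j => ?_
      by_cases hij : B i j = 0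
      · simp [hij]
      · have hcont : Continuous fun p : Matrix V V ℝ × Matrix V V ℝ × ℝ => p.1 i j := by fun_prop
        filter_upwards [hcont.continuousAt.eventually_ne hij] with p hp _ using hp
    · have hcont : Continuous fun p : Matrix V V ℝ × Matrix V V ℝ × ℝ => p.2.1 v v := by fun_prop
      exact hcont.continuousAt.eventually_ne hc
    · have hcont : Continuous fun p : Matrix V V ℝ × Matrix V V ℝ × ℝ =>
          (p.1, p.2.1 v v, Fintype.card ι * p.2.2 ^ 2) := by fun_prop
      refine hcont.continuousAt.eventually (p := fun q => Function.Injective (sspMap B v q)) ?_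
      simpa using eventually_injective_sspMap (hasSSP_sub_smul_one hSSP μ) hBdet v (B⁻¹ v v)
    · have hcont : Continuous fun p : Matrix V V ℝ × Matrix V V ℝ × ℝ =>
          borderedClique ι (p.1 + μ • 1) v μ p.2.2 (p.2.1 v v) := by
        unfold borderedClique
        fun_prop
      refine hcont.continuousAt.eventually_mem ?_
      convert hO using 2
      have h₀ : vecMulVec (Pi.single v 1) (fun _ : ι => (0 : ℝ)) = 0 := by
        ext; simp [vecMulVec_apply]
      have h₁ : vecMulVec (fun _ : ι => (0 : ℝ)) (Pi.single v 1) = 0 := by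
        ext; simp [vecMulVec_apply]
      have h₂ : vecMulVec (fun _ : ι => (0 : ℝ)) (fun _ : ι => (0 : ℝ)) = 0 := by
        ext; simp [vecMulVec_apply]
      simp [borderedClique, IEPG.directSum, hB, h₀, h₁, h₂]
  obtain ⟨H, U, r, ⟨hpat, hcU, hinj, hmem⟩, hr, hNU, hchar⟩ :=
    exists_isospectral_of_hasSSP hBsymm (hasSSP_sub_smul_one hSSP μ) hBdet
      (E := single v v 1) (by simp [IsSymm]) (Fintype.card ι) hnear
  dsimp only at hpat hcU hinj hmem
  set N := B + patternSymm B H with hN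
  have hNsymm : N.IsSymm := hBsymm.add (patternSymm_isSymm hBsymm H)
  have hNzero : ∀ i j, i ≠ j → (N i j ≠ 0 ↔ G.Adj i j) := by
    intro i j hij
    rw [← hAG i j hij, ← hBoff hij]
    refine ⟨fun h h0 => h ?_, hpat i j⟩
    simp [hN, patternSymm, hij, h0]
  refine ⟨_, r, _, hmem, ⟨hNsymm.add (isSymm_one.smul μ), fun i j hij => ?_⟩, hr.ne', hcU,
    hasSSP_borderedClique hNU hpat hr.ne' hcU hinj, charpoly_borderedClique hNsymm hNU v μ r hchar⟩
  simpa [hij] using hNzero i j hij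

end

theorem theorem3p5 {V : Type*} [Fintype V] [DecidableEq V] (G : SimpleGraph V)
    (A : Matrix V V ℝ) (hA : A ∈ IEPG.matricesOf G) (hSSP : IEPG.HasSSP A)
    (v : V) (μ : ℝ) (hμA : μ ∉ IEPG.spec A) (hμAv : μ ∉ IEPG.spec (IEPG.deleteVertex A v))
    (s : ℕ) (hs : 1 ≤ s) :
    ∀ U ∈ 𝓝 (IEPG.directSum A (μ • (1 : Matrix {x : Fin (s + 1) // x ≠ 0} _ ℝ))),
      ∃ A' ∈ U,
        A' ∈ IEPG.matricesOf
          (IEPG.vertexSum G v (SimpleGraph.completeGraph (Fin (s + 1))) 0) ∧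
        IEPG.HasSSP A' ∧
        IEPG.spec A' = IEPG.spec A + Multiset.replicate s μ ∧
        ∀ i : {x : Fin (s + 1) // x ≠ 0}, A' (Sum.inr i) (Sum.inr i) ≠ μ := by
  intro O hO
  have : Nonempty {x : Fin (s + 1) // x ≠ 0} :=
    ⟨⟨Fin.last s, fun h => by simp [Fin.ext_iff] at h; omega⟩⟩
  obtain ⟨B, r, c, hmem, ⟨hBsymm, hBG⟩, hr, hc, hS, hchar⟩ :=
    exists_borderedClique_mem_nhds hA hSSP hμA hμAv hO
  refine ⟨_, hmem, ⟨?_, ?_⟩, hS, ?_, fun i => ?_⟩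
  · refine IsSymm.fromBlocks hBsymm (transpose_vecMulVec _ _) ((isSymm_one.smul μ).add ?_)
    rw [IsSymm, transpose_vecMulVec]
    ext i j
    simp only [vecMulVec_apply]
    ring
  · rintro (i | i) (j | j) hij
    · exact hBG i j fun h => hij (h ▸ rfl)
    · simp [borderedClique, IEPG.vertexSum, vecMulVec_apply, hr, Pi.single_apply, j.2.symm]
    · simp [borderedClique, IEPG.vertexSum, vecMulVec_apply, hr, Pi.single_apply, i.2.symm]
    · have hij' : i ≠ j := fun h => hij (h ▸ rfl)
      simp [borderedClique, IEPG.vertexSum, vecMulVec_apply, hr, hc, hij',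
        Subtype.ext_iff.not.mp hij']
  · have h₀ : (Polynomial.X - Polynomial.C μ) ^ s ≠ 0 :=
      pow_ne_zero _ (Polynomial.X_sub_C_ne_zero μ)
    have hcard : Fintype.card {x : Fin (s + 1) // x ≠ 0} = s := by simp
    rw [IEPG.spec, hchar, hcard, Polynomial.roots_mul (mul_ne_zero h₀ A.charpoly_monic.ne_zero),
      Polynomial.roots_pow, Polynomial.roots_X_sub_C, Multiset.nsmul_singleton, add_comm, IEPG.spec]
  · simp [borderedClique, vecMulVec_apply, hr, hc]
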